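/- **Setting.** Let $(Y_i,\mathbf X_i,T_i)$, $i=1,2,\dots$, be iid, with $Y_i$ real, $T_i\in\{0,1\}$ and $\mathbf X_i=(\mathbf X_i^D,\mathbf X_i^C)\in\mathbb R^{d_D}\times\mathbb R^{d_C}$ a conditioning vector with $d_D$ discrete and $d_C$ continuous or mixed components; write $(Y,\mathbf X,T)$ for a generic observation. Let $\mathbf x_0=(\mathbf x_0^D,\mathbf x_0^C)$, let $F_{Y|\mathbf X,T}(\cdot\mid\mathbf x,t)$ be the CDFs of a regular conditional distribution of $Y$ given $(\mathbf X,T)$, and let $$H_{0r}\colon F_{Y|\mathbf X,T}(r\mid\mathbf x_0,0)=F_{Y|\mathbf X,T}(r\mid\mathbf x_0,1),\qquad r\in\mathbb R .$$ **Two-sample Dirichlet procedure at level $\alpha\in(0,1)$.** Let $B_{k,n}^{p}$ be the $p$-quantile of the $\mathrm{Beta}(k,n+1-k)$ distribution for $1\le k\le n$ (equal to $0$ for $p\le 0$ and $1$ for $p\ge 1$), $B_{0,n}^p=0$ and $B_{n+1,n}^p=1$. For samples $V_1,\dots,V_{n_V}$ and $W_1,\dots,W_{n_W}$ with empirical CDFs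 $\hat F_V,\hat F_W$, and for a pointwise level $a$, put $\hat\ell_V(r)=B^{a}_{n_V\hat F_V(r),\,n_V}$ and $\hat u_V(r)=B^{1-a}_{n_V\hat F_V(r)+1,\,n_V}$, and define $\hat\ell_W,\hat u_W$ in the same way. Reject equality of the two CDFs at $r$ if $\hat\ell_V(r)>\hat u_W(r)$ or $\hat\ell_W(r)>\hat u_V(r)$. The level used is $a=\tilde\alpha(\alpha,n_V,n_W)$, which is the supremum of the $a\in(0,1/2)$ for which the probability of rejecting at some $r\in\mathbb R$ is at most $\alpha$ when both samples are iid $\mathrm{Unif}(0,1)$ and independent of each other, minus $0.0001$. (The calibration probabilities are exact, i.e. this is the limit of infinitely many simulations. An empty sample leads to no rejection.) **Local samples.** Let $\|\cdot\|$ be a norm on $\mathbb R^{d_D+d_C}$; the value $\infty$ is allowed on vectors with a non-zero discrete part, so that exact matches of the discrete components may be ranked first. If $d_C>0$, assume that for some $c>0$, almost surely $\|\mathbf X-\mathbf x_0\|\ge c$ whenever $\mathbf X^D\ne\mathbf x_0^D$. Order the first $n$ observations by $\|\mathbf X_i-\mathbf x_0\|$, breaking ties by any measurable rule that depends only on the $(\mathbf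 X_i,T_i)$ and the indices. Given $q_0,q_1$, the local sample for $t\in\{0,1\}$ consists of the $Y_i$ of the first $q_t$ observations with $T_i=t$ in this order (all of them if there are fewer). The method applies the two-sample Dirichlet procedure to the two local samples. Its familywise error rate $\mathrm{FWER}_n$ is the probability that it rejects $H_{0r}$ for at least one $r$ for which $H_{0r}$ is true. **Theorem.** Assume $\Pr(\mathbf X^D=\mathbf x_0^D)>0$ and, for $t=0,1$: (i) $\mathbf x^C\mapsto F_{Y|\mathbf X,T}(y\mid(\mathbf x_0^D,\mathbf x^C),t)$ is continuous at $\mathbf x_0^C$ for every $y\in\mathbb R$; (ii) $\Pr(\mathbf X^D=\mathbf x_0^D,\,T=t)>0$ and $\Pr(\mathbf X^C-\mathbf x_0^C\in[-\epsilon,\epsilon]^{d_C}\mid\mathbf X^D=\mathbf x_0^D,\,T=t)>0$ for all $\epsilon>0$; (iii) $F_{Y|\mathbf X,T}(\cdot\mid\mathbf x_0,t)$ is continuous and strictly increasing on $\mathbb R$. Then, for all fixed $q_0,q_1$ and all $\alpha\in(0,1)$, the method has strong control of the FWER at a level approaching $\alpha$ asymptotically: whatever the set of true hypotheses, $$\limsup_{n\to\infty}\mathrm{FWER}_n\le\alpha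 .$$ If $d_C=0$, there is strong control of the FWER for every finite $n$. Let $N_t$ be the number of $i\le n$ with $(\mathbf X_i,T_i)=(\mathbf x_0,t)$. For all $m_0\ge q_0$ and $m_1\ge q_1$ such that $\Pr(N_0=m_0,\,N_1=m_1)>0$, the conditional probability given $N_0=m_0$, $N_1=m_1$ of at least one false rejection is at most $\alpha$. If the local samples consist of all exact matches, i.e. $q_t=N_t$, then unconditionally $\mathrm{FWER}_n\le\alpha$. -/

import Mathlib

open MeasureTheory ProbabilityTheory Filter Topology
open scoped ENNReal

noncomputable section

namespace CQD

/-! ### The two-sample Dirichlet multiple testing procedure -/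

/-- `betaQuantile k n p` is the `p`-quantile of the `Beta(k, n + 1 - k)` distribution for
`1 ≤ k ≤ n`, with the conventions that it is `0` for `k = 0` and `1` for `k ≥ n + 1`.
For levels `p ≤ 0` and `p ≥ 1` it is the left and right end point of `[0, 1]`. -/
def betaQuantile (k n : ℕ) (p : ℝ) : ℝ :=
  if k = 0 then 0
  else if n < k then 1
  else sInf {x : ℝ | x ∈ Set.Icc (0 : ℝ) 1 ∧
    min p 1 ≤ cdf (betaMeasure (k : ℝ) ((n : ℝ) + 1 - k)) x}

/-- `n F̂(r)`: the number of observations of the sample `(y i)_{i ∈ s}` that are at most `r`. -/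
def countLE {ι : Type*} (s : Finset ι) (y : ι → ℝ) (r : ℝ) : ℕ :=
  (s.filter fun i => y i ≤ r).card

/-- Lower band at `r`, with pointwise level `a`. -/
def lowerBand {ι : Type*} (a : ℝ) (s : Finset ι) (y : ι → ℝ) (r : ℝ) : ℝ :=
  betaQuantile (countLE s y r) s.card a

/-- Upper band at `r`, with pointwise level `a`. -/
def upperBand {ι : Type*} (a : ℝ) (s : Finset ι) (y : ι → ℝ) (r : ℝ) : ℝ :=
  betaQuantile (countLE s y r + 1) s.card (1 - a)

/-- With pointwise level `a`, the hypothesis `F_X(r) = F_Y(r)` is rejected on the basis of the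
samples `(x i)_{i ∈ s}` and `(y j)_{j ∈ s'}` when the two bands do not overlap at `r`. -/
def rejectsWith {ι ι' : Type*} (a : ℝ) (s : Finset ι) (x : ι → ℝ) (s' : Finset ι') (y : ι' → ℝ)
    (r : ℝ) : Prop :=
  lowerBand a s x r > upperBand a s' y r ∨ lowerBand a s' y r > upperBand a s x r

/-- The uniform distribution on `[0, 1]`. -/
def unif : Measure ℝ := volume.restrict (Set.Icc 0 1)

/-- The probability of rejecting at least one hypothesis, with pointwise level `a`, when the two
samples are independent iid standard uniform samples of sizes `nX` and `nY`. -/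
def nullFWER (a : ℝ) (nX nY : ℕ) : ℝ≥0∞ :=
  ((Measure.pi fun _ : Fin nX => unif).prod (Measure.pi fun _ : Fin nY => unif))
    {z | ∃ r : ℝ, rejectsWith a Finset.univ z.1 Finset.univ z.2 r}

/-- The calibrated pointwise level: the largest `a ∈ (0, 1/2)` for which the FWER for uniform
samples is at most `α` (with exact instead of simulated probabilities), minus `0.0001`. -/
def pointwiseLevel (α : ℝ) (nX nY : ℕ) : ℝ :=
  sSup {a : ℝ | a ∈ Set.Ioo (0 : ℝ) (1 / 2) ∧ nullFWER a nX nY ≤ ENNReal.ofReal α} - 1 / 10000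

/-- The two-sample, two-sided Dirichlet procedure at FWER level `α`: whether it rejects
`F_X(r) = F_Y(r)` given the samples `(x i)_{i ∈ s}` and `(y j)_{j ∈ s'}`. -/
def dirichletRejects {ι ι' : Type*} (α : ℝ) (s : Finset ι) (x : ι → ℝ) (s' : Finset ι')
    (y : ι' → ℝ) (r : ℝ) : Prop :=
  rejectsWith (pointwiseLevel α s.card s'.card) s x s' y r

/-! ### Nearest-neighbour local samples -/

/-- Values `x = (x^D, x^C)` of the conditioning vector, with `dD` discrete and `dC` continuous
(or mixed) components. -/
abbrev Cov (dD dC : ℕ) : Type := (Fin dD → ℝ) × (Fin dC → ℝ)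

/-- `D` is a norm on `ℝ^(dD + dC)`, except that it may take the value `∞` on vectors whose
discrete part is non-zero. Every norm qualifies, and so does the choice `‖x^C‖` for `x^D = 0` and
`∞` for `x^D ≠ 0`. -/
structure IsCovNorm {dD dC : ℕ} (D : Cov dD dC → ℝ≥0∞) : Prop where
  eq_zero_iff : ∀ x, D x = 0 ↔ x = 0
  smul : ∀ (c : ℝ) (x), D (c • x) = ENNReal.ofReal |c| * D x
  add_le : ∀ x y, D (x + y) ≤ D x + D y
  finite : ∀ v : Fin dC → ℝ, D (0, v) ≠ ∞

/-- `rank` ranks the `n` observations by the distance of their conditioning vector from `x₀`: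
`rank w i` is the position of observation `i` when the covariate data are `w i = (X_i, T_i)`.
Ties may be broken by any measurable rule that uses only the covariate data and the indices. -/
structure IsNearestRanking {dD dC n : ℕ} (D : Cov dD dC → ℝ≥0∞) (x₀ : Cov dD dC)
    (rank : (Fin n → Cov dD dC × Fin 2) → Equiv.Perm (Fin n)) : Prop where
  measurable : ∀ π : Equiv.Perm (Fin n), MeasurableSet {w | rank w = π}
  sorted : ∀ w i j, D ((w i).1 - x₀) < D ((w j).1 - x₀) → rank w i < rank w j

/-- The observations of the local sample of arm `t`: the first `q t` (all, if there are fewer)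
of the observations with `T_i = t`, in the order given by `rank`. -/
def localSample {dD dC n : ℕ} (rank : (Fin n → Cov dD dC × Fin 2) → Equiv.Perm (Fin n))
    (q : Fin 2 → ℕ) (w : Fin n → Cov dD dC × Fin 2) (t : Fin 2) : Finset (Fin n) :=
  Finset.univ.filter fun i => (w i).2 = t ∧
    (Finset.univ.filter fun j => (w j).2 = t ∧ rank w j < rank w i).card < q t

/-- Number of observations with `T_i = t` whose conditioning vector is exactly `x₀`. -/
def matchCount {dD dC n : ℕ} (x₀ : Cov dD dC) (w : Fin n → Cov dD dC × Fin 2) (t : Fin 2) : ℕ :=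
  by classical exact (Finset.univ.filter fun i => w i = (x₀, t)).card

/-- The conditional CDF `F_{Y|X,T}(y | x, t)` for the version `κ` of the conditional distribution
of `Y` given `(X, T)`. -/
def condCDFOf {dD dC : ℕ} (κ : Kernel (Cov dD dC × Fin 2) ℝ) (y : ℝ) (x : Cov dD dC)
    (t : Fin 2) : ℝ :=
  cdf (κ (x, t)) y

/-- On the data `(w i, y i) = ((X_i, T_i), Y_i)`, the two-sample Dirichlet procedure applied to the
two local samples rejects at least one true hypothesis
`F_{Y|X,T}(r | x₀, 0) = F_{Y|X,T}(r | x₀, 1)`. -/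
def FalselyRejects {dD dC n : ℕ} (α : ℝ) (κ : Kernel (Cov dD dC × Fin 2) ℝ) (x₀ : Cov dD dC)
    (rank : (Fin n → Cov dD dC × Fin 2) → Equiv.Perm (Fin n)) (q : Fin 2 → ℕ)
    (w : Fin n → Cov dD dC × Fin 2) (y : Fin n → ℝ) : Prop :=
  ∃ r : ℝ, condCDFOf κ r x₀ 0 = condCDFOf κ r x₀ 1 ∧
    dirichletRejects α (localSample rank q w 0) y (localSample rank q w 1) y r

end CQD

end

namespace CQD

/-! ### The two-sample procedure -/

/-! Rejection at `r` depends on the data only through the counts of observations at most `r`, so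
rejection somewhere depends only on the order pattern of the pooled sample. Hence a common monotone
change of scale is harmless, and so is a different one in each arm as long as only true hypotheses
matter. Transform each outcome by the conditional CDF of its own arm at `x₀`. If `H_{0r}` is true
with common value `p`, then `Y_i ≤ r` iff the transformed outcome is at most `p`, in both arms. A
false rejection therefore forces a rejection somewhere on the transformed data, whatever the set of
true hypotheses (`measure_exists_dirichletRejects_le`).

Given the covariates, the local samples are fixed index sets and the transformed outcomes are
independent. Exact matches are uniform by the probability integral transform, so the calibration
bounds the conditional probability by `α` (`pi_rejectionSet_le_of_matches`). Integrating over the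
covariates gives the finite-sample claims.

For the limit, covariates near `x₀` give transformed laws weakly close to uniform. The rejection set
has its boundary among vectors with ties, a null set for the uniform law, so the portmanteau theorem
bounds the rejection probability by `α + η` (`exists_pi_rejectionSet_le_add`). A small box around
`x₀` has positive probability in each arm and is closer than every admissible point outside a given
neighbourhood (`exists_near_set`). By Borel–Cantelli it eventually contains enough observations to
fill both local samples (`tendsto_measure_card_lt`). -/

lemma cdf_betaMeasure_one {a b : ℝ} (ha : 0 < a) (hb : 0 < b) :
    cdf (betaMeasure a b) 1 = 1 := by
  have := isProbabilityMeasureBeta ha hb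
  have h : betaMeasure a b (Set.Iic 1)ᶜ = 0 := by
    rw [betaMeasure, withDensity_apply _ measurableSet_Iic.compl]
    refine setLIntegral_eq_zero measurableSet_Iic.compl fun x hx => ?_
    simp only [Set.compl_Iic, Set.mem_Ioi] at hx
    exact betaPDF_eq_zero_of_one_le hx.le
  rw [cdf_eq_real, measureReal_def, (prob_compl_eq_zero_iff measurableSet_Iic).1 h]
  simp

lemma betaQuantile_nonneg (k n : ℕ) (p : ℝ) : 0 ≤ betaQuantile k n p := by
  unfold betaQuantile
  split_ifs
  · exact le_rfl
  · exact zero_le_one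
  · exact Real.sInf_nonneg fun x hx => hx.1.1

lemma betaQuantile_mono (k n : ℕ) {p p' : ℝ} (h : p ≤ p') :
    betaQuantile k n p ≤ betaQuantile k n p' := by
  unfold betaQuantile
  split_ifs with h0 h1
  · exact le_rfl
  · exact le_rfl
  · refine csInf_le_csInf ⟨0, fun x hx => hx.1.1⟩ ⟨1, ⟨zero_le_one, le_rfl⟩, ?_⟩
      fun x hx => ⟨hx.1, (min_le_min_right 1 h).trans hx.2⟩
    have hk : (1 : ℝ) ≤ k := by exact_mod_cast Nat.one_le_iff_ne_zero.2 h0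
    have hn : (k : ℝ) ≤ n := by exact_mod_cast not_lt.1 h1
    rw [cdf_betaMeasure_one (by linarith) (by linarith)]
    exact min_le_right _ _

lemma betaQuantile_of_nonpos {k n : ℕ} (hk : k ≤ n) {p : ℝ} (hp : p ≤ 0) :
    betaQuantile k n p = 0 := by
  refine le_antisymm ?_ (betaQuantile_nonneg _ _ _)
  unfold betaQuantile
  rw [if_neg (not_lt.2 hk)]
  split_ifs
  · exact le_rfl
  · exact csInf_le ⟨0, fun x hx => hx.1.1⟩
      ⟨⟨le_rfl, zero_le_one⟩, (min_le_left _ _).trans (hp.trans (cdf_nonneg _ _))⟩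

variable {ι ι' κ : Type*}

lemma countLE_le_card (s : Finset ι) (y : ι → ℝ) (r : ℝ) : countLE s y r ≤ s.card :=
  Finset.card_filter_le _ _

lemma rejectsWith_mono {a b : ℝ} (hab : a ≤ b) {s : Finset ι} {x : ι → ℝ} {s' : Finset ι'}
    {y : ι' → ℝ} {r : ℝ} (h : rejectsWith a s x s' y r) : rejectsWith b s x s' y r := by
  have hl : ∀ k n, betaQuantile k n a ≤ betaQuantile k n b := fun k n => betaQuantile_mono k n hab
  have hu : ∀ k n, betaQuantile k n (1 - b) ≤ betaQuantile k n (1 - a) :=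
    fun k n => betaQuantile_mono k n (by linarith)
  rcases h with h | h
  · exact Or.inl (lt_of_le_of_lt (hu _ _) (lt_of_lt_of_le h (hl _ _)))
  · exact Or.inr (lt_of_le_of_lt (hu _ _) (lt_of_lt_of_le h (hl _ _)))

lemma not_rejectsWith_of_nonpos {a : ℝ} (ha : a ≤ 0) (s : Finset ι) (x : ι → ℝ) (s' : Finset ι')
    (y : ι' → ℝ) (r : ℝ) : ¬ rejectsWith a s x s' y r := by
  rintro (h | h)
  · rw [lowerBand, betaQuantile_of_nonpos (countLE_le_card _ _ _) ha] at h
    exact absurd h (not_lt.2 (betaQuantile_nonneg _ _ _))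
  · rw [lowerBand, betaQuantile_of_nonpos (countLE_le_card _ _ _) ha] at h
    exact absurd h (not_lt.2 (betaQuantile_nonneg _ _ _))

/-- The calibrated procedure controls the FWER for uniform samples. -/
lemma nullFWER_pointwiseLevel_le (α : ℝ) (nX nY : ℕ) :
    nullFWER (pointwiseLevel α nX nY) nX nY ≤ ENNReal.ofReal α := by
  set S := {a : ℝ | a ∈ Set.Ioo (0 : ℝ) (1 / 2) ∧ nullFWER a nX nY ≤ ENNReal.ofReal α} with hS
  -- If no level qualifies, `sSup ∅ = 0` makes the calibrated level negative, and nothing is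
  -- rejected.
  rcases S.eq_empty_or_nonempty with h | h
  · have : pointwiseLevel α nX nY ≤ 0 := by
      rw [pointwiseLevel, ← hS, h, Real.sSup_empty]
      norm_num
    simp [nullFWER, not_rejectsWith_of_nonpos this]
  -- The subtracted 0.0001 leaves room for an admissible `a` above the level, so the supremum need
  -- not be attained.
  · obtain ⟨a, haS, ha⟩ := exists_lt_of_lt_csSup h
      (show sSup S - 1 / 10000 < sSup S by norm_num)
    refine le_trans (measure_mono ?_) haS.2
    rintro z ⟨r, hr⟩
    exact ⟨r, rejectsWith_mono ha.le hr⟩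

lemma countLE_map (s : Finset ι) (f : ι ↪ κ) (u : κ → ℝ) (r : ℝ) :
    countLE (s.map f) u r = countLE s (u ∘ f) r := by
  rw [countLE, Finset.filter_map, Finset.card_map]
  rfl

lemma countLE_congr {s : Finset ι} {u v : ι → ℝ} {r p : ℝ}
    (h : ∀ i ∈ s, u i ≤ r ↔ v i ≤ p) : countLE s u r = countLE s v p := by
  rw [countLE, countLE, Finset.filter_congr h]

/-- Only the counts enter the bands. Allowing both data and threshold to change covers moving `r` to
an observation, preserving the order pattern, and rescaling each arm separately. -/
lemma dirichletRejects_congr {α : ℝ} {s s' : Finset ι} {u v : ι → ℝ} {r p : ℝ}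
    (h : ∀ i ∈ s, u i ≤ r ↔ v i ≤ p) (h' : ∀ i ∈ s', u i ≤ r ↔ v i ≤ p)
    (hr : dirichletRejects α s u s' u r) : dirichletRejects α s v s' v p := by
  unfold dirichletRejects rejectsWith lowerBand upperBand at *
  rwa [← countLE_congr h, ← countLE_congr h']

lemma dirichletRejects_map {α : ℝ} {s : Finset ι} {s' : Finset ι'} (f : ι ↪ κ) (g : ι' ↪ κ)
    {u : κ → ℝ} {r : ℝ} :
    dirichletRejects α (s.map f) u (s'.map g) u r ↔
      dirichletRejects α s (u ∘ f) s' (u ∘ g) r := by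
  simp only [dirichletRejects, rejectsWith, lowerBand, upperBand, countLE_map, Finset.card_map]

/-! ### Rejection as a property of the order pattern -/

/-- The data on which the procedure rejects equality of the CDFs at some point. -/
def rejectionSet (α : ℝ) (s s' : Finset ι) : Set (ι → ℝ) :=
  {u | ∃ r, dirichletRejects α s u s' u r}

/-- A rejection at some point implies a rejection at one of the observations. -/
lemma exists_dirichletRejects_apply [Fintype ι] {α : ℝ} {s s' : Finset ι} {u : ι → ℝ} {r : ℝ}
    (h : dirichletRejects α s u s' u r) : ∃ j, dirichletRejects α s u s' u (u j) := by
  classical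
  -- Below all observations the lower bands are 0, so no rejection is possible there.
  have hne : (Finset.univ.filter fun i => u i ≤ r).Nonempty := by
    by_contra hc
    rw [Finset.not_nonempty_iff_eq_empty, Finset.filter_eq_empty_iff] at hc
    have h0 : ∀ t : Finset ι, countLE t u r = 0 := fun t => by
      rw [countLE, Finset.card_eq_zero, Finset.filter_eq_empty_iff]
      exact fun i _ => hc (Finset.mem_univ i)
    rcases h with h | h <;>
    · rw [lowerBand, h0, betaQuantile, if_pos rfl] at h
      exact absurd h (not_lt.2 (betaQuantile_nonneg _ _ _))
  obtain ⟨j, hj, hmax⟩ := Finset.exists_max_image _ u hne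
  simp only [Finset.mem_filter, Finset.mem_univ, true_and] at hj hmax
  have key : ∀ i, u i ≤ r ↔ u i ≤ u j := fun i => ⟨hmax i, fun hi => hi.trans hj⟩
  exact ⟨j, dirichletRejects_congr (fun i _ => key i) (fun i _ => key i) h⟩

/-- Rejection depends on the data only through their order pattern. -/
lemma mem_rejectionSet_of_order [Fintype ι] {α : ℝ} {s s' : Finset ι} {u v : ι → ℝ}
    (h : ∀ i j, u i ≤ u j ↔ v i ≤ v j) (hu : u ∈ rejectionSet α s s') :
    v ∈ rejectionSet α s s' := by
  obtain ⟨r, hr⟩ := hu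
  obtain ⟨j, hj⟩ := exists_dirichletRejects_apply hr
  exact ⟨v j, dirichletRejects_congr (fun i _ => h i j) (fun i _ => h i j) hj⟩

/-- The set is a preimage under the measurable map to order patterns, of which there are finitely
many. -/
lemma measurableSet_rejectionSet [Fintype ι] (α : ℝ) (s s' : Finset ι) :
    MeasurableSet (rejectionSet α s s') := by
  classical
  let f : (ι → ℝ) → (ι → ι → Prop) := fun u i j => u i ≤ u j
  have hf : Measurable f := by
    refine measurable_pi_lambda _ fun i => measurable_pi_lambda _ fun j => ?_
    exact measurableSet_setOfPred.1 (measurableSet_le (measurable_pi_apply i) (measurable_pi_apply j))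
  have : rejectionSet α s s' = f ⁻¹' (f '' rejectionSet α s s') := by
    refine Set.Subset.antisymm (Set.subset_preimage_image _ _) ?_
    rintro v ⟨u, hu, huv⟩
    exact mem_rejectionSet_of_order (fun i j => iff_of_eq (congrFun (congrFun huv i) j)) hu
  rw [this]
  exact hf (Set.toFinite _).measurableSet

lemma eventually_order_iff [Finite ι] {u : ι → ℝ} (hu : Function.Injective u) :
    ∀ᶠ v in 𝓝 u, ∀ i j, u i ≤ u j ↔ v i ≤ v j := by
  refine eventually_all.2 fun i => eventually_all.2 fun j => ?_
  rcases lt_trichotomy (u i) (u j) with h | h | h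
  · filter_upwards [((continuous_apply i).continuousAt (x := u)).eventually_lt
      ((continuous_apply j).continuousAt) h] with v hv
    exact iff_of_true h.le (le_of_lt hv)
  · rw [hu h]
    simp
  · filter_upwards [((continuous_apply j).continuousAt (x := u)).eventually_lt
      ((continuous_apply i).continuousAt) h] with v hv
    exact iff_of_false (not_le.2 h) (not_le.2 hv)

/-- Without ties the order pattern is locally constant, and so is membership in the rejection set.
-/
lemma frontier_rejectionSet_subset [Fintype ι] (α : ℝ) (s s' : Finset ι) :
    frontier (rejectionSet α s s') ⊆ {u | ¬ Function.Injective u} := by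
  intro u hu hinj
  have hev := eventually_order_iff hinj
  by_cases hm : u ∈ rejectionSet α s s'
  · refine hu.2 (mem_interior_iff_mem_nhds.2 ?_)
    filter_upwards [hev] with v hv
    exact mem_rejectionSet_of_order hv hm
  · obtain ⟨v, hv, hvR⟩ := (mem_closure_iff_frequently.1 hu.1).and_eventually hev |>.exists
    exact hm (mem_rejectionSet_of_order (fun i j => (hvR i j).symm) hv)

end CQD

namespace CQD

/-! ### Uniform samples and the probability integral transform -/

instance isProbabilityMeasure_unif : IsProbabilityMeasure unif := ⟨by simp [unif]⟩

instance nullSingletonClass_unif : NullSingletonClass unif := by unfold unif; infer_instance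

lemma unif_Iic {p : ℝ} (h1 : p ≤ 1) : unif (Set.Iic p) = ENNReal.ofReal p := by
  rw [unif, Measure.restrict_apply measurableSet_Iic]
  have : Set.Iic p ∩ Set.Icc 0 1 = Set.Icc 0 p := by
    ext x
    simp only [Set.mem_inter_iff, Set.mem_Iic, Set.mem_Icc]
    exact ⟨fun h => ⟨h.2.1, h.1⟩, fun h => ⟨h.2, h.1, h.2.trans h1⟩⟩
  rw [this, Real.volume_Icc, sub_zero]

/-- The probability integral transform. -/
lemma map_cdf_eq_unif (μ : Measure ℝ) [IsProbabilityMeasure μ] (hc : Continuous (cdf μ))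
    (hm : StrictMono (cdf μ)) : μ.map (cdf μ) = unif := by
  have : IsProbabilityMeasure (μ.map (cdf μ)) := Measure.isProbabilityMeasure_map hc.aemeasurable
  have hpos : ∀ y, 0 < cdf μ y := fun y =>
    (cdf_nonneg μ (y - 1)).trans_lt (hm (by linarith))
  refine Measure.ext_of_Iic _ _ fun p => ?_
  rw [Measure.map_apply hc.measurable measurableSet_Iic]
  rcases le_or_gt p 0 with h0 | h0
  · have h1 : cdf μ ⁻¹' Set.Iic p = ∅ := by
      ext y
      simpa using h0.trans_lt (hpos y)
    have h2 : unif (Set.Iic p) ≤ 0 := (measure_mono (Set.Iic_subset_Iic.2 h0)).trans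
      (by simp [unif_Iic zero_le_one])
    rw [h1, measure_empty]
    exact (le_antisymm h2 zero_le).symm
  rcases le_or_gt 1 p with h1 | h1
  · have h2 : cdf μ ⁻¹' Set.Iic p = Set.univ := by
      ext y
      simpa using (cdf_le_one μ y).trans h1
    have h3 : 1 ≤ unif (Set.Iic p) :=
      le_trans (by simp [unif_Iic le_rfl]) (measure_mono (Set.Iic_subset_Iic.2 h1))
    rw [h2, measure_univ]
    exact le_antisymm h3 prob_le_one
  · obtain ⟨v, hv⟩ : ∃ v, cdf μ v = p := by
      obtain ⟨a, ha⟩ := ((tendsto_order.1 (tendsto_cdf_atBot μ)).2 p h0).exists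
      obtain ⟨b, hb⟩ := ((tendsto_order.1 (tendsto_cdf_atTop μ)).1 p h1).exists
      exact mem_range_of_exists_le_of_exists_ge hc ⟨a, ha.le⟩ ⟨b, hb.le⟩
    have h2 : cdf μ ⁻¹' Set.Iic p = Set.Iic v := by
      ext y
      simp only [Set.mem_preimage, Set.mem_Iic, ← hv]
      exact hm.le_iff_le
    rw [h2, unif_Iic h1.le, ← ofReal_cdf, hv]

/-- Pointwise convergence of the CDFs implies weak convergence. -/
lemma tendsto_probabilityMeasure_of_tendsto_cdf {β : Type*} {l : Filter β}
    [l.IsCountablyGenerated] {μ : β → ProbabilityMeasure ℝ} {ν : ProbabilityMeasure ℝ}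
    (h : ∀ y, Tendsto (fun b => cdf (μ b : Measure ℝ) y) l (𝓝 (cdf (ν : Measure ℝ) y))) :
    Tendsto μ l (𝓝 ν) := by
  -- Half-open intervals form a π-system containing arbitrarily small neighbourhoods of every point,
  -- and their measures are differences of CDF values.
  refine (isPiSystem_Ioc (id : ℝ → ℝ) id).tendsto_probabilityMeasure_of_tendsto_of_mem ?_ ?_ ?_
  · rintro s ⟨a, b, -, rfl⟩
    exact measurableSet_Ioc
  · intro u hu x hx
    obtain ⟨ε, hε, hεu⟩ := Metric.isOpen_iff.1 hu x hx
    refine ⟨Set.Ioc (x - ε / 2) (x + ε / 2), ⟨_, _, by simp only [id]; linarith, rfl⟩,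
      Ioc_mem_nhds (by linarith) (by linarith), fun y hy => hεu ?_⟩
    rw [Metric.mem_ball, Real.dist_eq, abs_lt]
    constructor <;> linarith [hy.1, hy.2]
  · rintro s ⟨a, b, hab, rfl⟩
    simp only [id] at hab ⊢
    have key : ∀ ρ : ProbabilityMeasure ℝ, (ρ (Set.Ioc a b) : ℝ≥0∞) =
        ENNReal.ofReal (cdf (ρ : Measure ℝ) b - cdf (ρ : Measure ℝ) a) := fun ρ => by
      rw [ProbabilityMeasure.ennreal_coeFn_eq_coeFn_toMeasure]
      conv_lhs => rw [← measure_cdf (ρ : Measure ℝ)]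
      rw [StieltjesFunction.measure_Ioc]
    rw [← ENNReal.tendsto_coe]
    simp only [key]
    exact ENNReal.tendsto_ofReal ((h b).sub (h a))

variable {ι : Type*} [Fintype ι]

/-- A tie puts the vector in one of finitely many diagonals, each null by Fubini since the marginals
have no atoms. -/
lemma pi_not_injective (μ : ι → Measure ℝ) [∀ i, IsProbabilityMeasure (μ i)]
    [∀ i, NullSingletonClass (μ i)] : Measure.pi μ {u | ¬ Function.Injective u} = 0 := by
  have hsub : {u : ι → ℝ | ¬ Function.Injective u} ⊆
      ⋃ i, ⋃ j, ⋃ _ : i ≠ j, {u | u i = u j} := by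
    intro u hu
    simp only [Set.mem_ofPred_eq, Function.Injective, not_forall] at hu
    obtain ⟨i, j, h, hij⟩ := hu
    simp only [Set.mem_iUnion]
    exact ⟨i, j, hij, h⟩
  refine measure_mono_null hsub ?_
  simp only [measure_iUnion_null_iff]
  intro i j hij
  have hind : IndepFun (fun u : ι → ℝ => u i) (fun u => u j) (Measure.pi μ) :=
    (iIndepFun_pi (X := fun _ => id) fun _ => aemeasurable_id).indepFun hij
  have hmap := (indepFun_iff_map_prod_eq_prod_map_map (measurable_pi_apply i).aemeasurable
    (measurable_pi_apply j).aemeasurable).1 hind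
  have hdiag : MeasurableSet {z : ℝ × ℝ | z.1 = z.2} :=
    measurableSet_eq_fun measurable_fst measurable_snd
  have h0 : (Measure.pi μ).map (fun u => (u i, u j)) {z : ℝ × ℝ | z.1 = z.2} = 0 := by
    rw [hmap, (measurePreserving_eval μ i).map_eq, (measurePreserving_eval μ j).map_eq,
      Measure.measure_prod_null hdiag]
    refine Eventually.of_forall fun x => ?_
    have : Prod.mk x ⁻¹' {z : ℝ × ℝ | z.1 = z.2} = {x} := by
      ext y
      simp [eq_comm]
    simp [this]
  rwa [Measure.map_apply ((measurable_pi_apply i).prodMk (measurable_pi_apply j)) hdiag] at h0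

/-- If the laws of independent observations converge to the uniform distribution, then so do the
rejection probabilities. -/
lemma tendsto_pi_rejectionSet {β : Type*} {l : Filter β}
    {μ : β → ι → ProbabilityMeasure ℝ}
    (h : ∀ i, Tendsto (fun b => μ b i) l (𝓝 ⟨unif, inferInstance⟩)) (α : ℝ) (s s' : Finset ι) :
    Tendsto (fun b => Measure.pi (fun i => (μ b i : Measure ℝ)) (rejectionSet α s s')) l
      (𝓝 (Measure.pi (fun _ => unif) (rejectionSet α s s'))) := by
  have h1 := (ProbabilityMeasure.continuous_pi (α := fun _ : ι => ℝ)).tendsto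
    (fun _ => ⟨unif, inferInstance⟩) |>.comp (tendsto_pi_nhds.2 h)
  exact ProbabilityMeasure.tendsto_measure_of_null_frontier_of_tendsto' h1
    (measure_mono_null (frontier_rejectionSet_subset α s s') (pi_not_injective fun _ => unif))

/-- Coordinates of a product measure along an injection. -/
lemma map_pi_comp_injective {ι' : Type*} [Fintype ι'] {E : Type*} [MeasurableSpace E]
    (μ : ι → Measure E) [∀ i, IsProbabilityMeasure (μ i)] {e : ι' → ι}
    (he : Function.Injective e) :
    (Measure.pi μ).map (fun u => u ∘ e) = Measure.pi (fun j => μ (e j)) := by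
  have h : iIndepFun (fun j (u : ι → E) => u (e j)) (Measure.pi μ) :=
    (iIndepFun_pi (X := fun _ => id) fun _ => aemeasurable_id).precomp he
  refine (h.map_fun_eq_pi_map fun j => (measurable_pi_apply (e j)).aemeasurable).trans ?_
  congr
  ext1 j
  exact (measurePreserving_eval μ (e j)).map_eq

/-- The index set of the first sample in the disjoint union. -/
abbrev leftSample (m n : ℕ) : Finset (Fin m ⊕ Fin n) := Finset.univ.map .inl

/-- The index set of the second sample in the disjoint union. -/
abbrev rightSample (m n : ℕ) : Finset (Fin m ⊕ Fin n) := Finset.univ.map .inr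

lemma pi_unif_rejectionSet_le (α : ℝ) (m n : ℕ) :
    Measure.pi (fun _ => unif) (rejectionSet α (leftSample m n) (rightSample m n)) ≤
      ENNReal.ofReal α := by
  refine le_trans (le_of_eq ?_) (nullFWER_pointwiseLevel_le α m n)
  rw [nullFWER, ← (measurePreserving_sumPiEquivProdPi
    (X := fun _ : Fin m ⊕ Fin n => ℝ) fun _ => unif).measure_preimage_equiv]
  congr 1
  ext u
  simp only [rejectionSet, Set.mem_ofPred_eq, Set.mem_preimage, dirichletRejects_map]
  simp only [dirichletRejects, Finset.card_univ, Fintype.card_fin]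
  rfl

/-- The rejection probability depends only on the laws of the observations in the two samples. -/
lemma pi_rejectionSet_eq {n : ℕ} (μ : Fin n → Measure ℝ) [∀ i, IsProbabilityMeasure (μ i)]
    (α : ℝ) {s s' : Finset (Fin n)} (hd : Disjoint s s') {k k' : ℕ} (hk : s.card = k)
    (hk' : s'.card = k') :
    Measure.pi μ (rejectionSet α s s') =
      Measure.pi (fun j => μ (Sum.elim (s.orderEmbOfFin hk) (s'.orderEmbOfFin hk') j))
        (rejectionSet α (leftSample k k') (rightSample k k')) := by
  have hinj : Function.Injective (Sum.elim (s.orderEmbOfFin hk) (s'.orderEmbOfFin hk')) := by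
    refine Function.Injective.sumElim (RelEmbedding.injective _) (RelEmbedding.injective _) ?_
    intro i j h
    refine Finset.disjoint_left.1 hd (Finset.orderEmbOfFin_mem s hk i) ?_
    rw [h]
    exact Finset.orderEmbOfFin_mem s' hk' j
  have hme : Measurable fun u : Fin n → ℝ =>
      u ∘ Sum.elim (s.orderEmbOfFin hk) (s'.orderEmbOfFin hk') :=
    measurable_pi_lambda _ fun j => measurable_pi_apply _
  rw [← map_pi_comp_injective μ hinj,
    Measure.map_apply hme (measurableSet_rejectionSet _ _ _)]
  congr 1
  ext u
  have h1 : s = Finset.univ.map (s.orderEmbOfFin hk).toEmbedding := by simp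
  have h2 : s' = Finset.univ.map (s'.orderEmbOfFin hk').toEmbedding := by simp
  simp only [rejectionSet, Set.mem_ofPred_eq, Set.mem_preimage, dirichletRejects_map]
  conv_lhs => rw [h1, h2]
  simp only [dirichletRejects_map]
  rfl

end CQD

namespace CQD

/-! ### Conditioning on the covariates -/

/-- A bound for the conditional probabilities given the covariates integrates to a bound for the
joint probability. -/
lemma measure_le_of_forall_fiber {Ω Z : Type*} [MeasurableSpace Ω] [MeasurableSpace Z]
    {P : Measure Ω} [IsProbabilityMeasure P] {κ : Kernel Z ℝ} [IsMarkovKernel κ]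
    {n : ℕ} {W : Fin n → Ω → Z} {Y : Fin n → Ω → ℝ}
    (hW : ∀ i, Measurable (W i)) (hY : ∀ i, Measurable (Y i))
    (hindep : iIndepFun (fun i ω => (W i ω, Y i ω)) P)
    (hκ : ∀ i, HasCondDistrib (Y i) (W i) κ P)
    {B : Set ((Fin n → Z) × (Fin n → ℝ))} (hB : MeasurableSet B)
    {E : Set (Fin n → Z)} (hE : MeasurableSet E) (hBE : ∀ z ∈ B, z.1 ∈ E) {c : ℝ≥0∞}
    (hc : ∀ w ∈ E, Measure.pi (fun i => κ (w i)) {y | (w, y) ∈ B} ≤ c) :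
    P {ω | (fun i => W i ω, fun i => Y i ω) ∈ B} ≤ c * P {ω | (fun i => W i ω) ∈ E} := by
  -- Realise each outcome in law as `g (W i) U_i` with independent uniform `U_i`. The joint law
  -- becomes an image of a product measure, and conditioning on all covariates is Fubini.
  obtain ⟨g, hg, hgκ⟩ := Kernel.exists_measurable_map_eq_unitInterval κ
  have hg' : ∀ z, Measurable (g z) := fun z => hg.comp measurable_prodMk_left
  have hprob : ∀ i, IsProbabilityMeasure (P.map (W i)) := fun i =>
    Measure.isProbabilityMeasure_map (hW i).aemeasurable
  let G : Z × unitInterval → Z × ℝ := fun z => (z.1, g z.1 z.2)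
  have hG : Measurable G := measurable_fst.prodMk hg
  have hlaw : ∀ i, P.map (fun ω => (W i ω, Y i ω)) = ((P.map (W i)).prod volume).map G := by
    intro i
    rw [(hκ i).map_eq]
    ext s hs
    rw [Measure.compProd_apply hs, Measure.map_apply hG hs, Measure.prod_apply (hG hs)]
    refine lintegral_congr fun z => ?_
    rw [← hgκ z, Measure.map_apply (hg' z) (measurable_prodMk_left hs)]
    rfl
  let A := MeasurableEquiv.arrowProdEquivProdArrow Z ℝ (Fin n)
  have hWY : Measurable fun ω => fun i => (W i ω, Y i ω) :=
    measurable_pi_lambda _ fun i => (hW i).prodMk (hY i)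
  have hjoint : P.map (fun ω i => (W i ω, Y i ω)) =
      (Measure.pi fun i => (P.map (W i)).prod volume).map fun z i => G (z i) := by
    rw [hindep.map_fun_eq_pi_map fun i => ((hW i).prodMk (hY i)).aemeasurable]
    simp only [hlaw]
    have : ∀ i, IsProbabilityMeasure (((P.map (W i)).prod volume).map G) := fun i =>
      Measure.isProbabilityMeasure_map hG.aemeasurable
    rw [Measure.pi_map_pi fun i => hG.aemeasurable]
  have hGpi : Measurable fun (z : Fin n → Z × unitInterval) i => G (z i) :=
    measurable_pi_lambda _ fun i => hG.comp (measurable_pi_apply i)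
  have hWmap : P.map (fun ω i => W i ω) = Measure.pi fun i => P.map (W i) :=
    (hindep.comp (fun _ => Prod.fst) fun _ => measurable_fst).map_fun_eq_pi_map
      fun i => (hW i).aemeasurable
  let B' : Set ((Fin n → Z) × (Fin n → unitInterval)) :=
    {z | (z.1, fun i => g (z.1 i) (z.2 i)) ∈ B}
  have hmB' : MeasurableSet B' := by
    refine Measurable.prodMk measurable_fst (measurable_pi_lambda _ fun i => ?_) hB
    have h1 : Measurable fun z : (Fin n → Z) × (Fin n → unitInterval) => (z.1 i, z.2 i) := by
      fun_prop
    exact hg.comp h1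
  have h1 : P {ω | (fun i => W i ω, fun i => Y i ω) ∈ B} =
      ((Measure.pi fun i => P.map (W i)).prod (Measure.pi fun _ : Fin n => volume)) B' := by
    have e1 : {ω | (fun i => W i ω, fun i => Y i ω) ∈ B} =
        (fun ω i => (W i ω, Y i ω)) ⁻¹' (A ⁻¹' B) := rfl
    rw [e1, ← Measure.map_apply hWY (A.measurable hB), hjoint,
      Measure.map_apply hGpi (A.measurable hB),
      ← (measurePreserving_arrowProdEquivProdArrow Z unitInterval (Fin n)
        (fun i => P.map (W i)) fun _ => volume).measure_preimage_equiv]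
    rfl
  have h2 : P {ω | (fun i => W i ω) ∈ E} = (Measure.pi fun i => P.map (W i)) E := by
    rw [← hWmap, Measure.map_apply (measurable_pi_lambda _ hW) hE]
    rfl
  rw [h1, h2, Measure.prod_apply hmB', ← lintegral_indicator_const hE]
  refine lintegral_mono fun w => ?_
  by_cases hw : w ∈ E
  · rw [Set.indicator_of_mem hw]
    refine le_trans (le_of_eq ?_) (hc w hw)
    have : ∀ i, IsProbabilityMeasure (volume.map (g (w i))) := fun i => by
      rw [hgκ]
      infer_instance
    simp only [← hgκ]
    have hgw : Measurable fun (u : Fin n → unitInterval) i => g (w i) (u i) :=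
      measurable_pi_lambda _ fun i => (hg' (w i)).comp (measurable_pi_apply i)
    rw [← Measure.pi_map_pi fun i => (hg' (w i)).aemeasurable, Measure.map_apply hgw (show MeasurableSet {y | (w, y) ∈ B} from measurable_prodMk_left hB)]
    rfl
  · have : Prod.mk w ⁻¹' B' = ∅ := by
      ext u
      simp only [Set.mem_preimage, Set.mem_empty_iff_false, iff_false]
      exact fun hu => hw (hBE _ hu)
    rw [this, measure_empty]
    exact zero_le

end CQD

namespace CQD

variable {dD dC n : ℕ}

/-- The false rejection probability on an event determined by the covariates is bounded through
the laws of the transformed outcomes in the local samples. -/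
lemma measure_exists_dirichletRejects_le {Ω : Type*} [MeasurableSpace Ω]
    {P : Measure Ω} [IsProbabilityMeasure P] {κ : Kernel (Cov dD dC × Fin 2) ℝ} [IsMarkovKernel κ]
    {W : Fin n → Ω → Cov dD dC × Fin 2} {Y : Fin n → Ω → ℝ}
    (hW : ∀ i, Measurable (W i)) (hY : ∀ i, Measurable (Y i))
    (hindep : iIndepFun (fun i ω => (W i ω, Y i ω)) P)
    (hκ : ∀ i, HasCondDistrib (Y i) (W i) κ P)
    {x₀ : Cov dD dC} (hF : ∀ t, StrictMono (cdf (κ (x₀, t))))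
    {S : (Fin n → Cov dD dC × Fin 2) → Fin 2 → Finset (Fin n)}
    (hS : ∀ t i, MeasurableSet {w | i ∈ S w t}) (hSt : ∀ w t, ∀ i ∈ S w t, (w i).2 = t)
    {E : Set (Fin n → Cov dD dC × Fin 2)} (hE : MeasurableSet E) {α : ℝ} {c : ℝ≥0∞}
    (hc : ∀ w ∈ E, Measure.pi (fun i => (κ (w i)).map (cdf (κ (x₀, (w i).2))))
      (rejectionSet α (S w 0) (S w 1)) ≤ c) :
    P {ω | (fun i => W i ω) ∈ E ∧ ∃ r, condCDFOf κ r x₀ 0 = condCDFOf κ r x₀ 1 ∧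
      dirichletRejects α (S (fun i => W i ω) 0) (fun i => Y i ω) (S (fun i => W i ω) 1)
        (fun i => Y i ω) r} ≤ c * P {ω | (fun i => W i ω) ∈ E} := by
  have hFm : ∀ t, Measurable (cdf (κ (x₀, t))) := fun t => (hF t).monotone.measurable
  let f : Cov dD dC × Fin 2 → ℝ → ℝ := fun z => cdf (κ (x₀, z.2))
  have hf : Measurable (Function.uncurry f) := by
    have h1 : Measurable fun z : Fin 2 × ℝ => cdf (κ (x₀, z.1)) z.2 :=
      measurable_from_prod_countable_right fun t => hFm t
    exact h1.comp ((measurable_snd.comp measurable_fst).prodMk measurable_snd)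
  let u : (Fin n → Cov dD dC × Fin 2) × (Fin n → ℝ) → Fin n → ℝ := fun z i => f (z.1 i) (z.2 i)
  have hu : Measurable u := by
    refine measurable_pi_lambda _ fun i => ?_
    have h1 : Measurable fun z : (Fin n → Cov dD dC × Fin 2) × (Fin n → ℝ) => (z.1 i, z.2 i) := by
      fun_prop
    have h2 := hf.comp h1
    exact h2
  let B : Set ((Fin n → Cov dD dC × Fin 2) × (Fin n → ℝ)) :=
    {z | z.1 ∈ E ∧ u z ∈ rejectionSet α (S z.1 0) (S z.1 1)}
  have hSs : ∀ s : Fin 2 → Finset (Fin n), MeasurableSet {w | S w = s} := by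
    intro s
    have : {w | S w = s} = ⋂ t, ⋂ i, {w | i ∈ S w t ↔ i ∈ s t} := by
      ext w
      simp [funext_iff, Finset.ext_iff]
    rw [this]
    refine MeasurableSet.iInter fun t => MeasurableSet.iInter fun i => ?_
    by_cases h : i ∈ s t
    · exact (hS t i).congr (by ext w; simp [h])
    · exact (hS t i).compl.congr (by ext w; simp [h])
  have hB : MeasurableSet B := by
    -- The local samples take finitely many values; once they are fixed, the rejection set is fixed
    -- too.
    have : B = ⋃ s : Fin 2 → Finset (Fin n), {z | z.1 ∈ E} ∩ ({z | S z.1 = s} ∩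
        u ⁻¹' rejectionSet α (s 0) (s 1)) := by
      ext z
      simp only [B, Set.mem_iUnion, Set.mem_inter_iff, Set.mem_ofPred_eq, Set.mem_preimage]
      constructor
      · rintro ⟨h1, h2⟩
        exact ⟨S z.1, h1, rfl, h2⟩
      · rintro ⟨s, h1, rfl, h2⟩
        exact ⟨h1, h2⟩
    rw [this]
    exact MeasurableSet.iUnion fun s => (measurable_fst hE).inter
      ((measurable_fst (hSs s)).inter (hu (measurableSet_rejectionSet _ _ _)))
  refine le_trans (measure_mono ?_) (measure_le_of_forall_fiber hW hY hindep hκ hB hE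
    (fun z hz => hz.1) fun w hw => ?_)
  · rintro ω ⟨hω, r, hr, hrej⟩
    -- The truth of the hypothesis at `r` makes this one threshold serve both arms.
    refine ⟨hω, condCDFOf κ r x₀ 0, dirichletRejects_congr ?_ ?_ hrej⟩
    · intro i hi
      have ht : (W i ω).2 = 0 := hSt _ _ i hi
      simp only [u, f, ht]
      exact (hF 0).le_iff_le.symm
    · intro i hi
      have ht : (W i ω).2 = 1 := hSt _ _ i hi
      simp only [u, f, ht, hr]
      exact (hF 1).le_iff_le.symm
  · refine le_trans (le_of_eq ?_) (hc w hw)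
    have : ∀ i, IsProbabilityMeasure ((κ (w i)).map (cdf (κ (x₀, (w i).2)))) := fun i =>
      Measure.isProbabilityMeasure_map (hFm _).aemeasurable
    have hm : Measurable fun (y : Fin n → ℝ) i => cdf (κ (x₀, (w i).2)) (y i) :=
      measurable_pi_lambda _ fun i => (hFm _).comp (measurable_pi_apply i)
    rw [← Measure.pi_map_pi fun i => (hFm _).aemeasurable,
      Measure.map_apply hm (measurableSet_rejectionSet _ _ _)]
    congr 1
    ext y
    simp only [B, Set.mem_ofPred_eq, Set.mem_preimage, hw, true_and]
    rfl

/-! ### Local samples -/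

lemma measurable_card_filter {Z ι : Type*} [MeasurableSpace Z] [Fintype ι] {p : Z → ι → Prop}
    [∀ z, DecidablePred (p z)] (hp : ∀ i, MeasurableSet {z | p z i}) :
    Measurable fun z => (Finset.univ.filter (p z)).card := by
  simp only [Finset.card_filter]
  exact Finset.measurable_sum _ fun i _ => Measurable.ite (hp i) measurable_const measurable_const

variable {rank : (Fin n → Cov dD dC × Fin 2) → Equiv.Perm (Fin n)}
  {D : Cov dD dC → ℝ≥0∞} {x₀ : Cov dD dC}

/-- The sizes may depend on the covariates so that `q = matchCount` is included. -/
lemma measurableSet_mem_localSample (hrank : IsNearestRanking D x₀ rank)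
    {q : (Fin n → Cov dD dC × Fin 2) → Fin 2 → ℕ} (hq : ∀ t, Measurable fun w => q w t)
    (t : Fin 2) (i : Fin n) : MeasurableSet {w | i ∈ localSample rank (q w) w t} := by
  have htag : ∀ j : Fin n, MeasurableSet {w : Fin n → Cov dD dC × Fin 2 | (w j).2 = t} :=
    fun j => (measurable_snd.comp (measurable_pi_apply j)) (measurableSet_singleton t)
  have hlt : ∀ j, MeasurableSet {w | rank w j < rank w i} := by
    intro j
    have : {w | rank w j < rank w i} = ⋃ π : Equiv.Perm (Fin n), ⋃ _ : π j < π i,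
        {w | rank w = π} := by
      ext w
      simp
    rw [this]
    exact MeasurableSet.iUnion fun π => MeasurableSet.iUnion fun _ => hrank.measurable π
  have hcard : Measurable fun w : Fin n → Cov dD dC × Fin 2 =>
      (Finset.univ.filter fun j => (w j).2 = t ∧ rank w j < rank w i).card :=
    measurable_card_filter fun j => (htag j).inter (hlt j)
  refine ((htag i).inter (measurableSet_lt hcard (hq t))).congr ?_
  ext w
  simp [localSample]

lemma measurable_matchCount (x₀ : Cov dD dC) (t : Fin 2) :
    Measurable fun w : Fin n → Cov dD dC × Fin 2 => matchCount x₀ w t := by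
  classical
  unfold matchCount
  exact measurable_card_filter fun i => measurable_pi_apply i (measurableSet_singleton _)

lemma snd_of_mem_localSample {q : Fin 2 → ℕ} {w : Fin n → Cov dD dC × Fin 2} {t : Fin 2}
    {i : Fin n} (hi : i ∈ localSample rank q w t) : (w i).2 = t :=
  (Finset.mem_filter.1 hi).2.1

lemma disjoint_localSample {q : Fin 2 → ℕ} {w : Fin n → Cov dD dC × Fin 2} :
    Disjoint (localSample rank q w 0) (localSample rank q w 1) := by
  rw [Finset.disjoint_left]
  intro i hi hi'
  have := (snd_of_mem_localSample hi).symm.trans (snd_of_mem_localSample hi')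
  exact absurd this (by decide)

/-- Counting the same-arm observations ranked earlier is injective on the local sample, with values
below `q t`. -/
lemma card_localSample_le (q : Fin 2 → ℕ) (w : Fin n → Cov dD dC × Fin 2) (t : Fin 2) :
    (localSample rank q w t).card ≤ q t := by
  let g : Fin n → ℕ := fun i =>
    (Finset.univ.filter fun j => (w j).2 = t ∧ rank w j < rank w i).card
  have hg : ∀ i j, (w i).2 = t → rank w i < rank w j → g i < g j := by
    intro i j hi hij
    refine Finset.card_lt_card ⟨fun k hk => ?_, fun hsub => ?_⟩
    · simp only [Finset.mem_filter, Finset.mem_univ, true_and] at hk ⊢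
      exact ⟨hk.1, hk.2.trans hij⟩
    · have : i ∈ Finset.univ.filter fun k => (w k).2 = t ∧ rank w k < rank w i :=
        hsub (by simp [hi, hij])
      simp at this
  have := Finset.card_le_card_of_injOn (s := localSample rank q w t)
    (t := Finset.range (q t)) g (fun i hi => ?_) fun i hi j hj hij => ?_
  · simpa using this
  · exact Finset.mem_coe.2 (Finset.mem_range.2 (Finset.mem_filter.1 (Finset.mem_coe.1 hi)).2.2)
  · rcases lt_trichotomy (rank w i) (rank w j) with h | h | h
    · exact absurd hij (hg i j (snd_of_mem_localSample (Finset.mem_coe.1 hi)) h).ne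
    · exact (rank w).injective h
    · exact absurd hij (hg j i (snd_of_mem_localSample (Finset.mem_coe.1 hj)) h).ne'

/-- An observation is not selected if sufficiently many others are closer. -/
lemma notMem_localSample (hrank : IsNearestRanking D x₀ rank) {q : Fin 2 → ℕ}
    {w : Fin n → Cov dD dC × Fin 2} {t : Fin 2} {i : Fin n} {M : Finset (Fin n)}
    (hM : ∀ j ∈ M, (w j).2 = t ∧ D ((w j).1 - x₀) < D ((w i).1 - x₀)) (hq : q t ≤ M.card) :
    i ∉ localSample rank q w t := by
  intro hi
  refine (Finset.mem_filter.1 hi).2.2.not_ge (hq.trans (Finset.card_le_card fun j hj => ?_))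
  simp only [Finset.mem_filter, Finset.mem_univ, true_and]
  exact ⟨(hM j hj).1, hrank.sorted _ _ _ (hM j hj).2⟩

/-- The local samples consist of exact matches if there are sufficiently many of these. -/
lemma eq_of_mem_localSample (hD : IsCovNorm D) (hrank : IsNearestRanking D x₀ rank)
    {q : Fin 2 → ℕ} {w : Fin n → Cov dD dC × Fin 2} {t : Fin 2} {i : Fin n}
    (hq : q t ≤ matchCount x₀ w t) (hi : i ∈ localSample rank q w t) : w i = (x₀, t) := by
  classical
  by_contra hne
  have hx : (w i).1 ≠ x₀ := fun h => hne (Prod.ext h (snd_of_mem_localSample hi))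
  have hpos : 0 < D ((w i).1 - x₀) :=
    pos_iff_ne_zero.2 fun h => hx (sub_eq_zero.1 ((hD.eq_zero_iff _).1 h))
  refine notMem_localSample hrank (M := Finset.univ.filter fun j => w j = (x₀, t)) ?_ ?_ hi
  · intro j hj
    rw [(Finset.mem_filter.1 hj).2]
    simpa [(hD.eq_zero_iff 0).2 rfl] using hpos
  · refine hq.trans (le_of_eq ?_)
    unfold matchCount
    congr

/-- Given local samples of exact matches, the false rejection probability is at most the level. -/
lemma pi_rejectionSet_le_of_matches {κ : Kernel (Cov dD dC × Fin 2) ℝ} [IsMarkovKernel κ]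
    (hF : ∀ t, Continuous (cdf (κ (x₀, t))) ∧ StrictMono (cdf (κ (x₀, t)))) (α : ℝ)
    {w : Fin n → Cov dD dC × Fin 2} {s s' : Finset (Fin n)} (hd : Disjoint s s')
    (hs : ∀ i ∈ s, w i = (x₀, 0)) (hs' : ∀ i ∈ s', w i = (x₀, 1)) :
    Measure.pi (fun i => (κ (w i)).map (cdf (κ (x₀, (w i).2)))) (rejectionSet α s s') ≤
      ENNReal.ofReal α := by
  have : ∀ i, IsProbabilityMeasure ((κ (w i)).map (cdf (κ (x₀, (w i).2)))) := fun i =>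
    Measure.isProbabilityMeasure_map (hF _).1.aemeasurable
  rw [pi_rejectionSet_eq _ α hd rfl rfl]
  refine le_trans (le_of_eq ?_) (pi_unif_rejectionSet_le α s.card s'.card)
  congr
  funext j
  rcases j with j | j
  · simp only [Sum.elim_inl, hs _ (Finset.orderEmbOfFin_mem s rfl j)]
    exact map_cdf_eq_unif _ (hF 0).1 (hF 0).2
  · simp only [Sum.elim_inr, hs' _ (Finset.orderEmbOfFin_mem s' rfl j)]
    exact map_cdf_eq_unif _ (hF 1).1 (hF 1).2

end CQD

namespace CQD

variable {dD dC : ℕ}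

/-! ### Approximation of the conditional laws near the point of interest -/

/-- If the covariates in the local samples are sufficiently close to `x₀`, then the false
rejection probability hardly exceeds the level. -/
lemma exists_pi_rejectionSet_le_add {κ : Kernel (Cov dD dC × Fin 2) ℝ} [IsMarkovKernel κ]
    {x₀ : Cov dD dC}
    (hcont : ∀ (t : Fin 2) (y : ℝ), ContinuousAt (fun xC => condCDFOf κ y (x₀.1, xC) t) x₀.2)
    (hF : ∀ t, Continuous (cdf (κ (x₀, t))) ∧ StrictMono (cdf (κ (x₀, t)))) (α : ℝ)
    (q : Fin 2 → ℕ) {η : ℝ≥0∞} (hη : 0 < η) :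
    ∃ ε > 0, ∀ (n : ℕ) (w : Fin n → Cov dD dC × Fin 2) (s : Fin 2 → Finset (Fin n)),
      Disjoint (s 0) (s 1) → (∀ t, (s t).card ≤ q t) →
      (∀ t, ∀ i ∈ s t, (w i).2 = t ∧ (w i).1.1 = x₀.1 ∧ dist (w i).1.2 x₀.2 < ε) →
      Measure.pi (fun i => (κ (w i)).map (cdf (κ (x₀, (w i).2)))) (rejectionSet α (s 0) (s 1)) ≤
        ENNReal.ofReal α + η := by
  have hlim : ∀ k k' : ℕ, ∀ᶠ b in 𝓝 (fun _ : Fin k ⊕ Fin k' => x₀.2),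
      Measure.pi (fun j => (κ ((x₀.1, b j), Sum.elim (fun _ => 0) (fun _ => 1) j)).map
        (cdf (κ (x₀, Sum.elim (fun _ => 0) (fun _ => 1) j))))
        (rejectionSet α (leftSample k k') (rightSample k k')) < ENNReal.ofReal α + η := by
    intro k k'
    set τ : Fin k ⊕ Fin k' → Fin 2 := Sum.elim (fun _ => 0) (fun _ => 1)
    let μ : (Fin k ⊕ Fin k' → Fin dC → ℝ) → Fin k ⊕ Fin k' → ProbabilityMeasure ℝ :=
      fun b j => ProbabilityMeasure.map ⟨κ ((x₀.1, b j), τ j), inferInstance⟩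
        (hF (τ j)).1.aemeasurable
    have hμ : ∀ j, Tendsto (fun b => μ b j) (𝓝 fun _ => x₀.2) (𝓝 ⟨unif, inferInstance⟩) := by
      intro j
      let ν : ProbabilityMeasure ℝ := ⟨κ (x₀, τ j), inferInstance⟩
      have hν : ν.map (hF (τ j)).1.aemeasurable = ⟨unif, inferInstance⟩ :=
        Subtype.ext (map_cdf_eq_unif _ (hF (τ j)).1 (hF (τ j)).2)
      rw [← hν]
      refine ProbabilityMeasure.tendsto_map_of_tendsto_of_continuous
        (fun b : Fin k ⊕ Fin k' → Fin dC → ℝ => ⟨κ ((x₀.1, b j), τ j), inferInstance⟩) ν ?_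
        (hF (τ j)).1
      refine tendsto_probabilityMeasure_of_tendsto_cdf fun y => ?_
      exact (hcont (τ j) y).tendsto.comp ((continuous_apply j).tendsto fun _ => x₀.2)
    refine (tendsto_pi_rejectionSet hμ α _ _).eventually_lt_const ?_
    exact (pi_unif_rejectionSet_le α k k').trans_lt
      (ENNReal.lt_add_right ENNReal.ofReal_ne_top hη.ne')
  -- Only finitely many pairs of sample sizes occur, so one radius works for all of them and for
  -- every `n`.
  have hε : ∀ᶠ ε in 𝓝[>] (0 : ℝ), ∀ k : Fin (q 0 + 1), ∀ k' : Fin (q 1 + 1),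
      ∀ b : Fin k ⊕ Fin k' → Fin dC → ℝ, (∀ j, dist (b j) x₀.2 < ε) →
      Measure.pi (fun j => (κ ((x₀.1, b j), Sum.elim (fun _ => 0) (fun _ => 1) j)).map
        (cdf (κ (x₀, Sum.elim (fun _ => 0) (fun _ => 1) j))))
        (rejectionSet α (leftSample k k') (rightSample k k')) < ENNReal.ofReal α + η := by
    refine eventually_all.2 fun k => eventually_all.2 fun k' => ?_
    obtain ⟨δ, hδ, h⟩ := Metric.eventually_nhds_iff.1 (hlim k k')
    filter_upwards [Ioo_mem_nhdsGT hδ] with ε hε b hb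
    refine h ((dist_pi_lt_iff hδ).2 fun j => (hb j).trans hε.2)
  obtain ⟨ε, hε, hε0⟩ := (hε.and self_mem_nhdsWithin).exists
  refine ⟨ε, hε0, fun n w s hd hcard hs => ?_⟩
  have hpr : ∀ i, IsProbabilityMeasure ((κ (w i)).map (cdf (κ (x₀, (w i).2)))) := fun i =>
    Measure.isProbabilityMeasure_map (hF _).1.aemeasurable
  rw [pi_rejectionSet_eq _ α hd rfl rfl]
  set e := Sum.elim ((s 0).orderEmbOfFin rfl) ((s 1).orderEmbOfFin rfl) with he
  have hej : ∀ j, (w (e j)).2 = Sum.elim (fun _ => 0) (fun _ => 1) j ∧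
      (w (e j)).1.1 = x₀.1 ∧ dist (w (e j)).1.2 x₀.2 < ε := by
    rintro (j | j)
    · exact hs 0 _ (Finset.orderEmbOfFin_mem _ _ _)
    · exact hs 1 _ (Finset.orderEmbOfFin_mem _ _ _)
  refine le_trans (le_of_eq ?_) (hε ⟨_, Nat.lt_succ_of_le (hcard 0)⟩
    ⟨_, Nat.lt_succ_of_le (hcard 1)⟩ (fun j => (w (e j)).1.2) fun j => (hej j).2.2).le
  congr
  funext j
  have hw : w (e j) = ((x₀.1, (w (e j)).1.2), Sum.elim (fun _ => 0) (fun _ => 1) j) :=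
    Prod.ext (Prod.ext (hej j).2.1 rfl) (hej j).1
  rw [(hej j).1]
  exact congrArg (fun z => (κ z).map _) hw

/-! ### The local samples concentrate at the point of interest -/

/-- Infinitely many of independent events of equal positive probability occur. -/
lemma tendsto_measure_card_lt {Ω : Type*} [MeasurableSpace Ω] {P : Measure Ω}
    [IsProbabilityMeasure P] {A : ℕ → Set Ω} [∀ i ω, Decidable (ω ∈ A i)]
    (hA : ∀ i, MeasurableSet (A i)) (hind : iIndepSet A P) {p : ℝ≥0∞} (hp : p ≠ 0)
    (hPA : ∀ i, P (A i) = p) (q : ℕ) :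
    Tendsto (fun n => P {ω | (Finset.univ.filter fun i : Fin n => ω ∈ A i).card < q}) atTop
      (𝓝 0) := by
  have hcard : ∀ (n : ℕ) ω, (Finset.univ.filter fun i : Fin n => ω ∈ A i).card =
      ((Finset.range n).filter fun i => ω ∈ A i).card := fun n ω => by
    rw [Finset.card_filter, Finset.card_filter]
    exact Fin.sum_univ_eq_sum_range (fun i => if ω ∈ A i then 1 else 0) n
  have hm : ∀ n, MeasurableSet {ω | (Finset.univ.filter fun i : Fin n => ω ∈ A i).card < q} :=
    fun n => measurableSet_lt (measurable_card_filter (p := fun ω (i : Fin n) => ω ∈ A i)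
      fun i => hA i) measurable_const
  have hanti : Antitone fun n => {ω | (Finset.univ.filter fun i : Fin n => ω ∈ A i).card < q} := by
    intro m n hmn ω hω
    simp only [Set.mem_ofPred_eq, hcard] at hω ⊢
    exact (Finset.card_le_card (Finset.filter_subset_filter _
      (Finset.range_subset_range.2 hmn))).trans_lt hω
  have hlimsup : P (limsup A atTop) = 1 := measure_limsup_eq_one hA hind (by
    simp only [hPA]
    exact ENNReal.tsum_const_eq_top_of_ne_zero hp)
  have h0 : P (⋂ n, {ω | (Finset.univ.filter fun i : Fin n => ω ∈ A i).card < q}) = 0 := by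
    -- If infinitely many events occur, some `q` of them do, and any `n` beyond their indices has
    -- count at least `q`.
    refine measure_mono_null ?_ ((prob_compl_eq_zero_iff (.measurableSet_limsup hA)).2 hlimsup)
    intro ω hω hlim
    rw [mem_limsup_iff_frequently_mem, Nat.frequently_atTop_iff_infinite] at hlim
    obtain ⟨t, ht, htc⟩ := hlim.exists_subset_card_eq q
    have := Set.mem_iInter.1 hω (t.sup id + 1)
    rw [Set.mem_ofPred_eq, hcard] at this
    refine this.not_ge (htc ▸ Finset.card_le_card fun i hi => Finset.mem_filter.2 ⟨?_, ht hi⟩)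
    exact Finset.mem_range.2 (Nat.lt_succ_of_le (Finset.le_sup (f := id) hi))
  rw [← h0]
  exact tendsto_measure_iInter_atTop (fun n => (hm n).nullMeasurableSet) hanti
    ⟨0, measure_ne_top _ _⟩

/-- Seminorms on finite-dimensional spaces are continuous. -/
lemma continuous_of_seminorm {E : Type*} [NormedAddCommGroup E] [NormedSpace ℝ E]
    [FiniteDimensional ℝ E] {p : E → ℝ} (hsmul : ∀ (a : ℝ) v, p (a • v) = |a| * p v)
    (hadd : ∀ u v, p (u + v) ≤ p u + p v) : Continuous p := by
  have hconv : ConvexOn ℝ Set.univ p := by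
    refine ⟨convex_univ, fun u _ v _ a b ha hb _ => (hadd _ _).trans_eq ?_⟩
    rw [hsmul, hsmul, abs_of_nonneg ha, abs_of_nonneg hb, smul_eq_mul, smul_eq_mul]
  exact continuousOn_univ.1 (hconv.continuousOn isOpen_univ)

/-- The vectors of finite norm form a subspace, closed in finite dimension. The norm is continuous
on it and constantly `∞` off it. -/
lemma IsCovNorm.measurable {D : Cov dD dC → ℝ≥0∞} (hD : IsCovNorm D) : Measurable D := by
  let V : Submodule ℝ (Cov dD dC) :=
    { carrier := {x | D x ≠ ∞}
      add_mem' := fun {x y} hx hy => ne_top_of_le_ne_top (ENNReal.add_ne_top.2 ⟨hx, hy⟩)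
        (hD.add_le x y)
      zero_mem' := by simp [(hD.eq_zero_iff 0).2 rfl]
      smul_mem' := fun a x hx => by
        rw [Set.mem_ofPred_eq, hD.smul]
        exact ENNReal.mul_ne_top ENNReal.ofReal_ne_top hx }
  have hV : MeasurableSet (V : Set (Cov dD dC)) := V.closed_of_finiteDimensional.measurableSet
  have hcont : Continuous fun x : V => (D x).toReal := by
    refine continuous_of_seminorm (fun a x => ?_) fun x y => ?_
    · rw [Submodule.coe_smul, hD.smul, ENNReal.toReal_mul, ENNReal.toReal_ofReal (abs_nonneg a)]
    · exact (ENNReal.toReal_mono (ENNReal.add_ne_top.2 ⟨x.2, y.2⟩) (hD.add_le x y)).trans_eq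
        (ENNReal.toReal_add x.2 y.2)
  refine measurable_of_restrict_of_restrict_compl hV ?_ ?_
  · have : (V : Set (Cov dD dC)).domRestrict D = fun x : V => ENNReal.ofReal (D x).toReal :=
      funext fun x => (ENNReal.ofReal_toReal x.2).symm
    rw [this]
    exact (ENNReal.continuous_ofReal.comp hcont).measurable
  · have : (V : Set (Cov dD dC))ᶜ.domRestrict D = fun _ => ∞ :=
      funext fun x => not_not.1 x.2
    rw [this]
    exact measurable_const

/-- On the continuous components the norm is equivalent to the sup norm. -/
lemma IsCovNorm.exists_box {D : Cov dD dC → ℝ≥0∞} (hD : IsCovNorm D) {ε : ℝ} (hε : 0 < ε)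
    {c : ℝ≥0∞} (hc : 0 < c) :
    ∃ δ > 0, ∀ v : Fin dC → ℝ, (∀ k, v k ∈ Set.Icc (-δ) δ) → D (0, v) < c ∧
      ∀ u : Fin dC → ℝ, ε ≤ ‖u‖ → D (0, v) < D (0, u) := by
  let p : (Fin dC → ℝ) → ℝ := fun v => (D (0, v)).toReal
  have hDp : ∀ v, D (0, v) = ENNReal.ofReal (p v) := fun v =>
    (ENNReal.ofReal_toReal (hD.finite v)).symm
  have hp0 : ∀ v, 0 ≤ p v := fun v => ENNReal.toReal_nonneg
  have hsmul : ∀ (a : ℝ) v, p (a • v) = |a| * p v := fun a v => by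
    have := hD.smul a (0, v)
    rw [Prod.smul_mk, smul_zero] at this
    simp only [p, this, ENNReal.toReal_mul, ENNReal.toReal_ofReal (abs_nonneg a)]
  have hadd : ∀ u v, p (u + v) ≤ p u + p v := fun u v => by
    have := hD.add_le (0, u) (0, v)
    rw [Prod.mk_add_mk, add_zero] at this
    exact (ENNReal.toReal_mono (ENNReal.add_ne_top.2 ⟨hD.finite u, hD.finite v⟩) this).trans_eq
      (ENNReal.toReal_add (hD.finite u) (hD.finite v))
  have hcont : Continuous p := continuous_of_seminorm hsmul hadd
  obtain ⟨m, hm, hmp⟩ : ∃ m > 0, ∀ u ∈ Metric.sphere (0 : Fin dC → ℝ) 1, m ≤ p u := by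
    rcases (Metric.sphere (0 : Fin dC → ℝ) 1).eq_empty_or_nonempty with h | h
    · exact ⟨1, one_pos, by simp [h]⟩
    · obtain ⟨u₀, hu₀, hmin⟩ := (isCompact_sphere _ _).exists_isMinOn h hcont.continuousOn
      refine ⟨p u₀, (hp0 _).lt_of_ne' fun h0 => ?_, fun u hu => hmin hu⟩
      have : D (0, u₀) = 0 := by rw [hDp, h0, ENNReal.ofReal_zero]
      have : u₀ = 0 := congrArg Prod.snd ((hD.eq_zero_iff _).1 this)
      simp [this] at hu₀
  have hlow : ∀ u : Fin dC → ℝ, ε ≤ ‖u‖ → m * ε ≤ p u := fun u hu => by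
    have hu0 : 0 < ‖u‖ := hε.trans_le hu
    have h1 := hmp (‖u‖⁻¹ • u) (by simp [norm_smul, hu0.ne'])
    rw [hsmul, abs_of_pos (inv_pos.2 hu0), ← div_eq_inv_mul, le_div_iff₀ hu0] at h1
    exact (mul_le_mul_of_nonneg_left hu hm.le).trans h1
  have hD0 : Tendsto (fun v => D (0, v)) (𝓝 0) (𝓝 0) := by
    have := ENNReal.tendsto_ofReal (hcont.tendsto 0)
    rw [← hDp, show ((0 : Fin dD → ℝ), (0 : Fin dC → ℝ)) = 0 from rfl,
      (hD.eq_zero_iff 0).2 rfl] at this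
    simpa only [← hDp] using this
  -- The bound `c` beats points with other discrete components; `m * ε` is the least norm possible
  -- at sup-distance `ε`, by compactness of the unit sphere and scaling.
  have hpos : 0 < min c (ENNReal.ofReal (m * ε)) :=
    lt_min hc (ENNReal.ofReal_pos.2 (mul_pos hm hε))
  obtain ⟨δ, hδ, hball⟩ := Metric.nhds_basis_closedBall.eventually_iff.1
    (hD0.eventually_lt_const hpos)
  refine ⟨δ, hδ, fun v hv => ?_⟩
  have hv' : D (0, v) < min c (ENNReal.ofReal (m * ε)) := hball (by
    rw [mem_closedBall_zero_iff, pi_norm_le_iff_of_nonneg hδ.le]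
    exact fun k => abs_le.2 (hv k))
  refine ⟨hv'.trans_le (min_le_left _ _), fun u hu => (hv'.trans_le (min_le_right _ _)).trans_le ?_⟩
  rw [hDp u]
  exact ENNReal.ofReal_le_ofReal (hlow u hu)

/-- There is a set of covariate values with positive probability in both arms that is closer to
`x₀` than all values outside of a given neighbourhood. -/
lemma exists_near_set {Ω : Type*} [MeasurableSpace Ω] {P : Measure Ω} {X : Ω → Cov dD dC}
    {T : Ω → Fin 2} (hX : Measurable X) (hT : Measurable T) {x₀ : Cov dD dC}
    (hmass : ∀ (t : Fin 2) (ε : ℝ), 0 < ε →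
      0 < ProbabilityTheory.cond P {ω | (X ω).1 = x₀.1 ∧ T ω = t}
        {ω | ∀ k, (X ω).2 k - x₀.2 k ∈ Set.Icc (-ε) ε})
    {D : Cov dD dC → ℝ≥0∞} (hD : IsCovNorm D)
    {c : ℝ≥0∞} (hc : 0 < c) {ε : ℝ} (hε : 0 < ε) :
    ∃ N : Set (Cov dD dC), MeasurableSet N ∧ (∀ t, P {ω | X ω ∈ N ∧ T ω = t} ≠ 0) ∧
      ∀ x', (dC ≠ 0 → x'.1 ≠ x₀.1 → c ≤ D (x' - x₀)) →
        (x'.1 = x₀.1 ∧ dist x'.2 x₀.2 < ε) ∨ ∀ x ∈ N, D (x - x₀) < D (x' - x₀) := by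
  have hN : ∀ δ : ℝ, MeasurableSet
      {x : Cov dD dC | x.1 = x₀.1 ∧ ∀ k, x.2 k - x₀.2 k ∈ Set.Icc (-δ) δ} := fun δ => by
    have h1 : MeasurableSet {x : Cov dD dC | x.1 = x₀.1} :=
      measurable_fst (measurableSet_singleton x₀.1)
    have h2 : MeasurableSet {x : Cov dD dC | ∀ k, x.2 k - x₀.2 k ∈ Set.Icc (-δ) δ} := by
      rw [Set.ofPred_forall]
      refine MeasurableSet.iInter fun k => ?_
      have : Measurable fun x : Cov dD dC => x.2 k - x₀.2 k := by fun_prop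
      exact this measurableSet_Icc
    exact h1.inter h2
  have hpos : ∀ δ : ℝ, 0 < δ → ∀ t, P {ω | X ω ∈
      {x : Cov dD dC | x.1 = x₀.1 ∧ ∀ k, x.2 k - x₀.2 k ∈ Set.Icc (-δ) δ} ∧ T ω = t} ≠ 0 := by
    intro δ hδ t h0
    have hms : MeasurableSet {ω | (X ω).1 = x₀.1 ∧ T ω = t} :=
      ((measurable_fst.comp hX) (measurableSet_singleton x₀.1)).inter
        (hT (measurableSet_singleton t))
    refine (hmass t δ hδ).ne' ?_
    rw [cond_apply hms]
    refine mul_eq_zero_of_right _ (measure_mono_null ?_ h0)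
    rintro ω ⟨⟨h1, h2⟩, h3⟩
    exact ⟨⟨h1, h3⟩, h2⟩
  by_cases hdC : dC = 0
  · subst hdC
    -- Without continuous components the box is `{x₀}` for any radius.
    refine ⟨_, hN 1, hpos 1 one_pos, fun x' _ => ?_⟩
    by_cases hω : x'.1 = x₀.1
    · exact Or.inl ⟨hω, by rwa [Subsingleton.elim x'.2 x₀.2, dist_self]⟩
    · refine Or.inr fun x hx => ?_
      have hx0 : x - x₀ = 0 := sub_eq_zero.2 (Prod.ext hx.1 (Subsingleton.elim _ _))
      rw [hx0, (hD.eq_zero_iff 0).2 rfl]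
      refine pos_iff_ne_zero.2 fun h => hω ?_
      rw [sub_eq_zero.1 ((hD.eq_zero_iff _).1 h)]
  · obtain ⟨δ, hδ, hbox⟩ := hD.exists_box hε hc
    have hsub : ∀ x : Cov dD dC, x.1 = x₀.1 → x - x₀ = (0, x.2 - x₀.2) := fun x hx =>
      Prod.ext (sub_eq_zero.2 hx) rfl
    refine ⟨_, hN δ, hpos δ hδ, fun x' hx' => ?_⟩
    by_cases h1 : x'.1 = x₀.1
    · refine (lt_or_ge (dist x'.2 x₀.2) ε).imp (fun h2 => ⟨h1, h2⟩) fun h2 x hx => ?_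
      rw [hsub x hx.1, hsub _ h1]
      exact (hbox _ hx.2).2 _ (by rwa [← dist_eq_norm])
    · refine Or.inr fun x hx => ?_
      rw [hsub x hx.1]
      exact (hbox _ hx.2).1.trans_le (hx' hdC h1)

end CQD

/-! ### The main theorem -/

theorem mainTheorem9
    {Ω : Type*} [MeasurableSpace Ω] (P : Measure Ω) [IsProbabilityMeasure P]
    (dD dC : ℕ)
    -- the data `(Y_i, X_i, T_i)`, with `X_i = (X_i^D, X_i^C)`
    (Y : ℕ → Ω → ℝ) (X : ℕ → Ω → CQD.Cov dD dC) (T : ℕ → Ω → Fin 2)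
    (hYm : ∀ i, Measurable (Y i)) (hXm : ∀ i, Measurable (X i)) (hTm : ∀ i, Measurable (T i))
    -- iid sampling
    (hindep : iIndepFun (fun i ω => (Y i ω, X i ω, T i ω)) P)
    (hident : ∀ i, IdentDistrib (fun ω => (Y i ω, X i ω, T i ω))
      (fun ω => (Y 0 ω, X 0 ω, T 0 ω)) P P)
    -- `κ` is a version of the conditional distribution of `Y` given `(X, T)`
    (κ : Kernel (CQD.Cov dD dC × Fin 2) ℝ) [IsMarkovKernel κ]
    (hκ : HasCondDistrib (Y 0) (fun ω => (X 0 ω, T 0 ω)) κ P)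
    (x₀ : CQD.Cov dD dC)
    (hpos : 0 < P {ω | (X 0 ω).1 = x₀.1})
    -- continuity of the conditional CDFs in the continuous components at the point of interest
    (hcont : ∀ (t : Fin 2) (y : ℝ),
      ContinuousAt (fun xC => CQD.condCDFOf κ y (x₀.1, xC) t) x₀.2)
    -- positive mass near the point of interest
    (hmass : ∀ (t : Fin 2) (ε : ℝ), 0 < ε →
      0 < ProbabilityTheory.cond P {ω | (X 0 ω).1 = x₀.1 ∧ T 0 ω = t}
        {ω | ∀ k, (X 0 ω).2 k - x₀.2 k ∈ Set.Icc (-ε) ε})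
    -- the two conditional CDFs are continuous and strictly increasing on `ℝ`
    (hF : ∀ t : Fin 2, Continuous (fun y => CQD.condCDFOf κ y x₀ t) ∧
      StrictMono (fun y => CQD.condCDFOf κ y x₀ t))
    -- the norm, which separates `x₀` from points with other discrete components
    (D : CQD.Cov dD dC → ℝ≥0∞) (hD : CQD.IsCovNorm D)
    (hsep : dC ≠ 0 → ∃ c : ℝ≥0∞, 0 < c ∧
      ∀ᵐ ω ∂P, (X 0 ω).1 ≠ x₀.1 → c ≤ D (X 0 ω - x₀))
    (rank : (n : ℕ) → (Fin n → CQD.Cov dD dC × Fin 2) → Equiv.Perm (Fin n))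
    (hrank : ∀ n, CQD.IsNearestRanking D x₀ (rank n))
    (q : Fin 2 → ℕ) (α : ℝ) (hα₀ : 0 < α) (hα₁ : α < 1) :
    -- asymptotic strong control of the FWER
    limsup (fun n : ℕ => P {ω | CQD.FalselyRejects α κ x₀ (rank n) q
        (fun i : Fin n => (X i ω, T i ω)) (fun i : Fin n => Y i ω)}) atTop ≤ ENNReal.ofReal α ∧
    -- finite-sample strong control of the FWER with discrete conditioning variables only
    (dC = 0 → ∀ n : ℕ,
      -- given the numbers of exact matches, provided that these suffice for the local samples
      (∀ m : Fin 2 → ℕ, q ≤ m →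
        ProbabilityTheory.cond P
          {ω | CQD.matchCount x₀ (fun i : Fin n => (X i ω, T i ω)) = m}
          {ω | CQD.FalselyRejects α κ x₀ (rank n) q
            (fun i : Fin n => (X i ω, T i ω)) (fun i : Fin n => Y i ω)} ≤ ENNReal.ofReal α) ∧
      -- unconditionally, when the local samples consist of all exact matches
      P {ω | CQD.FalselyRejects α κ x₀ (rank n)
          (CQD.matchCount x₀ (fun i : Fin n => (X i ω, T i ω)))
          (fun i : Fin n => (X i ω, T i ω)) (fun i : Fin n => Y i ω)} ≤ ENNReal.ofReal α) := by
  have hZm : ∀ i, Measurable fun ω => (X i ω, T i ω) := fun i => (hXm i).prodMk (hTm i)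
  have hswap : Measurable fun z : ℝ × CQD.Cov dD dC × Fin 2 => (z.2, z.1) :=
    measurable_snd.prodMk measurable_fst
  have hind : iIndepFun (fun i ω => ((X i ω, T i ω), Y i ω)) P :=
    hindep.comp (fun _ z => (z.2, z.1)) fun _ => hswap
  have hid : ∀ i, IdentDistrib (fun ω => ((X i ω, T i ω), Y i ω))
      (fun ω => ((X 0 ω, T 0 ω), Y 0 ω)) P P := fun i => (hident i).comp hswap
  have hidZ : ∀ i, IdentDistrib (fun ω => (X i ω, T i ω)) (fun ω => (X 0 ω, T 0 ω)) P P :=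
    fun i => (hid i).comp measurable_fst
  have hκi : ∀ i, HasCondDistrib (Y i) (fun ω => (X i ω, T i ω)) κ P := fun i =>
    { aemeasurable := ((hZm i).prodMk (hYm i)).aemeasurable
      map_eq := by rw [(hid i).map_eq, hκ.map_eq, (hidZ i).map_eq] }
  have hindn : ∀ n : ℕ, iIndepFun (fun (i : Fin n) ω => ((X i ω, T i ω), Y i ω)) P := fun n =>
    hind.precomp Fin.val_injective
  have hFm : ∀ t, StrictMono (cdf (κ (x₀, t))) := fun t => (hF t).2
  refine ⟨?_, fun _ n => ?_⟩
  · refine ENNReal.le_of_forall_pos_le_add fun η hη _ => ?_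
    obtain ⟨ε, hε, hnear⟩ := CQD.exists_pi_rejectionSet_le_add hcont hF α q
      (ENNReal.coe_pos.2 hη)
    obtain ⟨c, hc, hsep'⟩ : ∃ c : ℝ≥0∞, 0 < c ∧
        ∀ᵐ ω ∂P, dC ≠ 0 → (X 0 ω).1 ≠ x₀.1 → c ≤ D (X 0 ω - x₀) := by
      by_cases h : dC = 0
      · exact ⟨1, one_pos, by simp [h]⟩
      · obtain ⟨c, hc, hsepc⟩ := hsep h
        exact ⟨c, hc, hsepc.mono fun ω hω _ => hω⟩
    obtain ⟨N, hN, hNpos, hNsep⟩ := CQD.exists_near_set (hXm 0) (hTm 0) hmass hD hc hε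
    have hsepi : ∀ᵐ ω ∂P, ∀ i, dC ≠ 0 → (X i ω).1 ≠ x₀.1 → c ≤ D (X i ω - x₀) := by
      refine ae_all_iff.2 fun i => ?_
      have hms : MeasurableSet {x : CQD.Cov dD dC | dC ≠ 0 → x.1 ≠ x₀.1 → c ≤ D (x - x₀)} := by
        by_cases h : dC = 0
        · simp [h]
        · have h1 : MeasurableSet {x : CQD.Cov dD dC | x.1 = x₀.1} :=
            measurable_fst (measurableSet_singleton x₀.1)
          have h2 : MeasurableSet {x : CQD.Cov dD dC | c ≤ D (x - x₀)} :=
            measurableSet_le measurable_const (hD.measurable.comp (measurable_id.sub_const x₀))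
          refine (h1.union h2).congr ?_
          ext x
          simp [h, imp_iff_not_or]
      exact ((hidZ i).comp measurable_fst).symm.ae_snd hms hsep'
    let A : Fin 2 → ℕ → Set Ω := fun t i => {ω | X i ω ∈ N ∧ T i ω = t}
    have hNt : ∀ t : Fin 2, MeasurableSet (N ×ˢ {t} : Set (CQD.Cov dD dC × Fin 2)) := fun t =>
      hN.prod (measurableSet_singleton t)
    have hA : ∀ t i, A t i = (fun ω => (X i ω, T i ω)) ⁻¹' (N ×ˢ {t}) := fun t i => rfl
    have hAm : ∀ t i, MeasurableSet (A t i) := fun t i => hZm i (hNt t)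
    have hAP : ∀ t i, P (A t i) = P (A t 0) := fun t i => (hidZ i).measure_mem_eq (hNt t)
    have hAind : ∀ t, iIndepSet (A t) P := fun t => by
      rw [iIndepSet_iff_meas_biInter (hAm t)]
      intro s
      exact (hind.comp (fun _ z => z.1) fun _ => measurable_fst).measure_inter_preimage_eq_mul s
        fun i _ => hNt t
    classical
    -- Off the bad events, at least `q t` observations in `N` outrank anything outside the
    -- `ε`-neighbourhood, almost surely, so both local samples lie inside it.
    let bad : Fin 2 → ℕ → Set Ω := fun t n =>
      {ω | (Finset.univ.filter fun i : Fin n => ω ∈ A t i).card < q t}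
    have hbad : ∀ t, Tendsto (fun n => P (bad t n)) atTop (𝓝 0) := fun t =>
      CQD.tendsto_measure_card_lt (hAm t) (hAind t) (hNpos t) (hAP t) (q t)
    have hlim : Tendsto (fun n => (ENNReal.ofReal α + η) + (P (bad 0 n) + P (bad 1 n))) atTop
        (𝓝 (ENNReal.ofReal α + η)) := by
      simpa using tendsto_const_nhds (x := ENNReal.ofReal α + (η : ℝ≥0∞)) |>.add
        ((hbad 0).add (hbad 1))
    rw [← hlim.limsup_eq]
    refine limsup_le_limsup (Eventually.of_forall fun n => ?_)
    let E : Set (Fin n → CQD.Cov dD dC × Fin 2) :=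
      {w | ∀ t, ∀ i ∈ CQD.localSample (rank n) q w t,
        (w i).1.1 = x₀.1 ∧ dist (w i).1.2 x₀.2 < ε}
    have hS : ∀ t i, MeasurableSet {w | i ∈ CQD.localSample (rank n) q w t} := fun t i =>
      CQD.measurableSet_mem_localSample (hrank n) (q := fun _ => q) (fun _ => measurable_const) t i
    have hE : MeasurableSet E := by
      have hset : E = ⋂ t, ⋂ i, ({w | i ∈ CQD.localSample (rank n) q w t}ᶜ ∪
          ({w | (w i).1.1 = x₀.1} ∩ {w | dist (w i).1.2 x₀.2 < ε})) := by
        ext w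
        simp [E, imp_iff_not_or]
      rw [hset]
      refine MeasurableSet.iInter fun t => MeasurableSet.iInter fun i => ?_
      have h1 : Measurable fun w : Fin n → CQD.Cov dD dC × Fin 2 => (w i).1.1 := by fun_prop
      have h2 : Measurable fun w : Fin n → CQD.Cov dD dC × Fin 2 => (w i).1.2 := by fun_prop
      exact (hS t i).compl.union ((h1 (measurableSet_singleton x₀.1)).inter
        (h2 Metric.isOpen_ball.measurableSet))
    have hEc : P {ω | (fun i : Fin n => (X i ω, T i ω)) ∉ E} ≤ P (bad 0 n) + P (bad 1 n) := by
      refine le_trans (measure_mono_ae ?_) (measure_union_le _ _)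
      filter_upwards [hsepi] with ω hω hωE
      by_contra hgood
      have hq : ∀ t, q t ≤ (Finset.univ.filter fun i : Fin n => ω ∈ A t i).card := by
        intro t
        by_contra hlt
        refine hgood ?_
        fin_cases t
        · exact Or.inl (not_le.1 hlt)
        · exact Or.inr (not_le.1 hlt)
      refine hωE fun t i hi => ?_
      refine (hNsep (X i ω) (hω i)).resolve_right fun hfar => ?_
      refine CQD.notMem_localSample (hrank n) (fun j hj => ?_) (hq t) hi
      have hj' := (Finset.mem_filter.1 hj).2
      exact ⟨hj'.2, hfar _ hj'.1⟩
    have hmain := CQD.measure_exists_dirichletRejects_le (fun i : Fin n => hZm i)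
      (fun i : Fin n => hYm i) (hindn n) (fun i => hκi i) hFm
      (S := fun w t => CQD.localSample (rank n) q w t) hS
      (fun w t i hi => CQD.snd_of_mem_localSample hi) hE (α := α) (c := ENNReal.ofReal α + η)
      fun w hw => hnear n w (CQD.localSample (rank n) q w) CQD.disjoint_localSample
        (CQD.card_localSample_le q w) fun t i hi => ⟨CQD.snd_of_mem_localSample hi, hw t i hi⟩
    refine le_trans (measure_mono fun ω hω => ?_) ((measure_union_le _ _).trans
      (add_le_add (hmain.trans (mul_le_of_le_one_right' prob_le_one)) hEc))
    by_cases hωE : (fun i : Fin n => (X i ω, T i ω)) ∈ E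
    · exact Or.inl ⟨hωE, hω⟩
    · exact Or.inr hωE
  -- One bound serves both claims: constant `q` on the event `matchCount = m`, and `q = matchCount`
  -- on the whole space.
  · have key : ∀ (qf : (Fin n → CQD.Cov dD dC × Fin 2) → Fin 2 → ℕ),
        (∀ t, Measurable fun w => qf w t) → ∀ E : Set (Fin n → CQD.Cov dD dC × Fin 2),
        MeasurableSet E → (∀ w ∈ E, qf w ≤ CQD.matchCount x₀ w) →
        P {ω | (fun i : Fin n => (X i ω, T i ω)) ∈ E ∧ CQD.FalselyRejects α κ x₀ (rank n)
          (qf fun i : Fin n => (X i ω, T i ω)) (fun i : Fin n => (X i ω, T i ω))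
          (fun i : Fin n => Y i ω)} ≤
        ENNReal.ofReal α * P {ω | (fun i : Fin n => (X i ω, T i ω)) ∈ E} := by
      intro qf hqf E hE hqE
      exact CQD.measure_exists_dirichletRejects_le (fun i : Fin n => hZm i)
        (fun i : Fin n => hYm i) (hindn n) (fun i => hκi i) hFm
        (S := fun w t => CQD.localSample (rank n) (qf w) w t)
        (CQD.measurableSet_mem_localSample (hrank n) hqf)
        (fun w t i hi => CQD.snd_of_mem_localSample hi) hE
        fun w hw => CQD.pi_rejectionSet_le_of_matches hF α CQD.disjoint_localSample
          (fun i hi => CQD.eq_of_mem_localSample hD (hrank n) (hqE w hw 0) hi)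
          fun i hi => CQD.eq_of_mem_localSample hD (hrank n) (hqE w hw 1) hi
    have hmc : ∀ t, Measurable fun w : Fin n → CQD.Cov dD dC × Fin 2 => CQD.matchCount x₀ w t :=
      CQD.measurable_matchCount x₀
    constructor
    · intro m hm
      have hE : MeasurableSet {w : Fin n → CQD.Cov dD dC × Fin 2 | CQD.matchCount x₀ w = m} :=
        (measurable_pi_lambda _ hmc) (measurableSet_singleton m)
      have hM : MeasurableSet
          {ω | CQD.matchCount x₀ (fun i : Fin n => (X i ω, T i ω)) = m} :=
        (measurable_pi_lambda _ fun i : Fin n => hZm i) hE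
      rw [cond_apply hM]
      refine (mul_le_mul_right (key (fun _ => q) (fun _ => measurable_const) _ hE
        fun w hw => hm.trans_eq hw.symm) _).trans ?_
      rw [mul_left_comm]
      -- This also covers a conditioning event of probability zero, where `cond` is the zero
      -- measure.
      exact mul_le_of_le_one_right' (ENNReal.inv_mul_le_one _)
    · have := key (CQD.matchCount x₀) hmc Set.univ MeasurableSet.univ fun w _ => le_rfl
      simpa using this
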